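/- Let $n\ge 0$, $m_1\ge 1$, $m_2\ge 0$ be integers and let $L_j = A_{j,0}+\sum_{i=1}^n X_iA_{j,i}$ ($j=1,2$) be linear pencils of sizes $m_1$ and $m_2$ in the same commuting variables $X_1,\dots,X_n$; that is, each $A_{j,i}$ is a real symmetric $m_j\times m_j$ matrix. Write $\succeq 0$ for "symmetric positive semidefinite". Let $$S_{L_j}=\{x\in\mathbb R^n : A_{j,0}+\textstyle\sum_i x_iA_{j,i}\succeq 0\}$$ be the spectrahedron of $L_j$, and let $$\mathfrak S_{L_j}=\bigcup_{d\ge 1}\Big\{(Z_1,\dots,Z_n) : Z_i\in\mathbb R^{d\times d}\text{ symmetric},\ I_d\otimes A_{j,0}+\textstyle\sum_i Z_i\otimes A_{j,i}\succeq 0\Big\}$$ be its matricial spectrahedron, where $\otimes$ is the Kronecker product. Suppose that $S_{L_1}$ is non-empty and bounded, and that the real linear span of $A_{1,0},A_{1,1},\dots,A_{1,n}$ contains a positive definite matrix. Then the following are equivalent: (i) $\mathfrak S_{L_1}\subseteq\mathfrak S_{L_2}$; (ii) there exist an integer $\mu\ge 1$ and a real matrix $V\in\mathbb R^{\mu m_1\times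 m_2}$ such that $$L_2=V^*\,(I_\mu\otimes L_1)\,V$$ as an identity of matrices over the polynomial ring $\mathbb R[X_1,\dots,X_n]$, where $V^*$ is the transpose of $V$. -/

import Mathlib

open scoped Kronecker

/-- A linear pencil `A₀ + X₁ A₁ + ⋯ + Xₙ Aₙ` of size `m` in `n` commuting variables, given by its
real symmetric coefficient matrices. -/
structure LinearPencil (n m : ℕ) where
  /-- the constant coefficient `A₀` -/
  const : Matrix (Fin m) (Fin m) ℝ
  /-- the coefficients `A₁, …, Aₙ` of the variables -/
  coeff : Fin n → Matrix (Fin m) (Fin m) ℝ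
  const_symm : const.IsSymm
  coeff_symm : ∀ i, (coeff i).IsSymm

namespace LinearPencil

variable {n m : ℕ}

/-- The pencil as a matrix with polynomial entries, `A₀ + ∑ Xᵢ Aᵢ`. -/
noncomputable def toPolyMatrix (L : LinearPencil n m) :
    Matrix (Fin m) (Fin m) (MvPolynomial (Fin n) ℝ) :=
  L.const.map MvPolynomial.C +
    ∑ i, (MvPolynomial.X i : MvPolynomial (Fin n) ℝ) • (L.coeff i).map MvPolynomial.C

/-- The evaluation `L(x) = A₀ + ∑ xᵢ Aᵢ` at a point `x` of `ℝⁿ`. -/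
def eval (L : LinearPencil n m) (x : Fin n → ℝ) : Matrix (Fin m) (Fin m) ℝ :=
  L.const + ∑ i, x i • L.coeff i

/-- The spectrahedron `S_L = {x ∈ ℝⁿ | L(x) ⪰ 0}`. -/
def spectrahedron (L : LinearPencil n m) : Set (Fin n → ℝ) :=
  {x | (L.eval x).PosSemidef}

/-- The evaluation `L(Z) = I_d ⊗ A₀ + ∑ Zᵢ ⊗ Aᵢ` at an `n`-tuple of `d × d` matrices. -/
def matEval (L : LinearPencil n m) {d : ℕ} (Z : Fin n → Matrix (Fin d) (Fin d) ℝ) :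
    Matrix (Fin d × Fin m) (Fin d × Fin m) ℝ :=
  (1 : Matrix (Fin d) (Fin d) ℝ) ⊗ₖ L.const + ∑ i, Z i ⊗ₖ L.coeff i

/-- The matricial spectrahedron: the (disjoint) union over `d ≥ 1` of the sets of `n`-tuples `Z` of
real symmetric `d × d` matrices with `L(Z) ⪰ 0`. -/
def matSpectrahedron (L : LinearPencil n m) :
    Set (Σ d : ℕ, (Fin n → Matrix (Fin d) (Fin d) ℝ)) :=
  {Z | 1 ≤ Z.1 ∧ (∀ i, (Z.2 i).IsSymm) ∧ (L.matEval Z.2).PosSemidef}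

/-- The operator system of `L`: the linear span of all coefficients `A₀, A₁, …, Aₙ`. -/
def operatorSystem (L : LinearPencil n m) : Submodule ℝ (Matrix (Fin m) (Fin m) ℝ) :=
  Submodule.span ℝ (insert L.const (Set.range L.coeff))

end LinearPencil

section

open Matrix

/-! ### Real positive semidefinite matrices. -/

namespace Matrix

section MatrixOrder
open scoped MatrixOrder Matrix.Norms.L2Operator

/-! Homogenize: to a tuple `B` attach `∑ B o ⊗ A o`, the constant term included. If positivity of
this for `L₁` implies it for `L₂`, Hahn-Banach gives the representation
(`exists_eq_sum_of_kronecker_of_eq_one`). Indeed the tuples `∑ Vₖᵀ A o Vₖ` form the image of the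
positive semidefinite cone under a linear map, closed once some combination of the `A o` is
definite. A functional separating the coefficients of `L₂` from this cone is a tuple `B`
contradicting the implication. The inclusion of matricial spectrahedra is the implication for `B
none = 1`. Congruence extends it to definite `B none`. Boundedness makes `B none` semidefinite, and
perturbing along an interior point of `S_{L₁}` handles that case
(`homEval_posSemidef_of_matSpectrahedron_subset`). -/

theorem PosDef.exists_isUnit_eq_transpose_mul_self {a : Type*} [Fintype a] [DecidableEq a]
    {M : Matrix a a ℝ} (hM : M.PosDef) : ∃ S : Matrix a a ℝ, IsUnit S ∧ M = Sᵀ * S := by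
  obtain ⟨y, hy, h⟩ := CStarAlgebra.isStrictlyPositive_iff_eq_star_mul_self.mp
    hM.isStrictlyPositive
  exact ⟨y, hy, by rw [h, star_eq_conjTranspose, conjTranspose_eq_transpose_of_trivial]⟩

end MatrixOrder

theorem posSemidef_real_iff {a : Type*} [Fintype a] {M : Matrix a a ℝ} :
    M.PosSemidef ↔ (∀ x y, M x y = M y x) ∧ ∀ v : a → ℝ, 0 ≤ ∑ x, ∑ y, v x * M x y * v y := by
  rw [posSemidef_iff_dotProduct_mulVec]
  refine and_congr ?_ (forall_congr' fun v ↦ ?_)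
  · simp only [IsHermitian, ← Matrix.ext_iff, conjTranspose_apply, star_trivial]
    exact ⟨fun h x y ↦ h y x, fun h x y ↦ h y x⟩
  · simp only [dotProduct, mulVec, star_trivial, Finset.mul_sum, mul_assoc]

/-- Testing on `e_x ± e_y` bounds `2|M x y|` by `M x x + M y y`. Hence a trace bound cuts a bounded
piece out of the cone. -/
theorem PosSemidef.abs_apply_le_trace {a : Type*} [Fintype a] [DecidableEq a]
    {M : Matrix a a ℝ} (hM : M.PosSemidef) (x y : a) : |M x y| ≤ ∑ z, M z z := by
  have hd : ∀ z, 0 ≤ M z z := fun z ↦ hM.diag_nonneg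
  have hle : ∀ z, M z z ≤ ∑ z, M z z := fun z ↦
    Finset.single_le_sum (f := fun z ↦ M z z) (fun z _ ↦ hd z) (Finset.mem_univ z)
  have hs : M y x = M x y := (posSemidef_real_iff.1 hM).1 y x
  have h : ∀ t : ℝ, 0 ≤ M x x + t * M x y + t * M y x + t * t * M y y := by
    intro t
    have := (posSemidef_iff_dotProduct_mulVec.1 hM).2 (Pi.single x 1 + t • Pi.single y 1)
    simp [mulVec_add, mulVec_smul, add_dotProduct, dotProduct_add] at this
    linarith
  have h1 := h 1
  have h2 := h (-1)
  have := hle x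
  have := hle y
  rw [abs_le]
  constructor <;> linarith

theorem isClosed_setOf_posSemidef (a : Type*) [Fintype a] :
    IsClosed {P : a → a → ℝ | (of P).PosSemidef} := by
  simp only [posSemidef_real_iff, of_apply, Set.ofPred_and, Set.ofPred_forall]
  refine IsClosed.inter ?_ ?_
  · exact isClosed_iInter fun x ↦ isClosed_iInter fun y ↦
      isClosed_eq (by fun_prop) (by fun_prop)
  · exact isClosed_iInter fun v ↦ isClosed_le (by fun_prop) (by fun_prop)

end Matrix

/-! ### The cone of sums of compressions and its dual. -/

section Cone

variable {ι a b : Type*} [Fintype ι] [Fintype a] [Fintype b]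

/-- The partial contraction `P ↦ (∑ (A i) x y P (x, p) (y, q))_i`, which sends the rank one
matrix of a vector `V` to the compressions `Vᵀ (A i) V`. -/
def contraction (A : ι → Matrix a a ℝ) :
    (a × b → a × b → ℝ) →ₗ[ℝ] (ι → b → b → ℝ) where
  toFun P i p q := ∑ x, ∑ y, A i x y * P (x, p) (y, q)
  map_add' P Q := by
    ext i p q
    simp [mul_add, Finset.sum_add_distrib]
  map_smul' c P := by
    ext i p q
    simp only [Pi.smul_apply, smul_eq_mul, RingHom.id_apply, Finset.mul_sum]
    exact Finset.sum_congr rfl fun x _ ↦ Finset.sum_congr rfl fun y _ ↦ by ring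

omit [Fintype ι] [Fintype b] in
theorem contraction_apply (A : ι → Matrix a a ℝ) (P : a × b → a × b → ℝ) (i : ι) (p q : b) :
    contraction A P i p q = ∑ x, ∑ y, A i x y * P (x, p) (y, q) := rfl

theorem trace_contraction [DecidableEq a] {A : ι → Matrix a a ℝ} {c : ι → ℝ}
    (hc : ∑ i, c i • A i = 1) (P : a × b → a × b → ℝ) :
    ∑ i, c i * ∑ p, contraction A P i p p = ∑ z, P z z := by
  have h : ∀ x y, ∑ i, c i * A i x y = if x = y then 1 else 0 := fun x y ↦ by
    simpa [Matrix.sum_apply, Matrix.one_apply] using congrFun (congrFun hc x) y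
  calc ∑ i, c i * ∑ p, contraction A P i p p
      = ∑ p, ∑ x, ∑ y, (∑ i, c i * A i x y) * P (x, p) (y, p) := by
        simp only [contraction_apply, Finset.mul_sum, Finset.sum_mul]
        rw [Finset.sum_comm]
        refine Finset.sum_congr rfl fun p _ ↦ ?_
        rw [Finset.sum_comm]
        refine Finset.sum_congr rfl fun x _ ↦ ?_
        rw [Finset.sum_comm]
        exact Finset.sum_congr rfl fun y _ ↦ Finset.sum_congr rfl fun i _ ↦ by ring
    _ = ∑ z, P z z := by
        simp only [h, ite_mul, one_mul, zero_mul, Finset.sum_ite_eq, Finset.mem_univ, if_true]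
        rw [Fintype.sum_prod_type_right]

/-- The functional `f` below recovers the trace of `P` from its image, so near any limit point the
image comes from a compact part of the cone. -/
theorem isClosed_image_contraction [DecidableEq a] [DecidableEq b] {A : ι → Matrix a a ℝ}
    {c : ι → ℝ} (hc : ∑ i, c i • A i = 1) :
    IsClosed (contraction A '' {P : a × b → a × b → ℝ | (of P).PosSemidef}) := by
  set C := {P : a × b → a × b → ℝ | (of P).PosSemidef}
  have hcont : Continuous (contraction (b := b) A) := LinearMap.continuous_of_finiteDimensional _
  let f : (ι → b → b → ℝ) → ℝ := fun y ↦ ∑ i, c i * ∑ p, y i p p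
  have hf : Continuous f := by fun_prop
  refine isClosed_of_closure_subset fun y hy ↦ ?_
  let R := f y + 1
  have hcomp : IsCompact (C ∩ Metric.closedBall 0 (max R 0)) :=
    (isCompact_closedBall _ _).inter_left (isClosed_setOf_posSemidef _)
  have hsub : contraction A '' C ∩ {z | f z < R} ⊆
      contraction A '' (C ∩ Metric.closedBall 0 (max R 0)) := by
    rintro _ ⟨⟨P, hP, rfl⟩, hR⟩
    refine ⟨P, ⟨hP, ?_⟩, rfl⟩
    have hR' : ∑ z, P z z < R := by
      rw [← trace_contraction hc]; exact hR
    rw [mem_closedBall_zero_iff, pi_norm_le_iff_of_nonneg (le_max_right _ _)]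
    intro x
    rw [pi_norm_le_iff_of_nonneg (le_max_right _ _)]
    intro z
    exact ((PosSemidef.abs_apply_le_trace hP x z).trans hR'.le).trans (le_max_left _ _)
  have hopen : IsOpen {z | f z < R} := isOpen_lt hf continuous_const
  have : y ∈ closure (contraction A '' C ∩ {z | f z < R}) := by
    rw [Set.inter_comm]
    exact hopen.inter_closure ⟨by simp [R], hy⟩
  have h2 := closure_minimal hsub (hcomp.image hcont).isClosed this
  exact Set.image_mono Set.inter_subset_left h2

omit [Fintype b] in
theorem sum_transpose_mul_mul_apply {κ : Type*} [Fintype κ] (A : Matrix a a ℝ)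
    (V : κ → Matrix a b ℝ) (p q : b) :
    (∑ k, (V k)ᵀ * A * V k) p q = ∑ k, ∑ x, ∑ y, V k x p * A x y * V k y q := by
  simp only [Matrix.sum_apply, Matrix.mul_apply, transpose_apply, Finset.sum_mul]
  exact Finset.sum_congr rfl fun k _ ↦ Finset.sum_comm

omit [Fintype ι] in
-- Split `P` into rank one terms and reshape each vector on `a × b` into a matrix.
theorem exists_eq_sum_of_mem_image_contraction {A : ι → Matrix a a ℝ} {Y : ι → Matrix b b ℝ}
    (h : (fun i p q ↦ Y i p q) ∈
      contraction A '' {P : a × b → a × b → ℝ | (of P).PosSemidef}) :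
    ∃ (μ : ℕ) (V : Fin μ → Matrix a b ℝ), ∀ i, Y i = ∑ k, (V k)ᵀ * A i * V k := by
  obtain ⟨P, hP, hPY⟩ := h
  obtain ⟨μ, v, hv⟩ := Matrix.posSemidef_iff_eq_sum_vecMulVec.1 hP
  refine ⟨μ, fun k ↦ of fun x p ↦ v k (x, p), fun i ↦ ?_⟩
  ext p q
  have hP' : ∀ z w, P z w = ∑ k, v k z * v k w := fun z w ↦ by
    simpa [Matrix.sum_apply, vecMulVec_apply] using congrFun (congrFun hv z) w
  have := congrFun (congrFun (congrFun hPY i) p) q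
  rw [sum_transpose_mul_mul_apply, ← this, contraction_apply]
  simp only [hP', Finset.mul_sum, of_apply]
  calc _ = ∑ x, ∑ k, ∑ y, A i x y * (v k (x, p) * v k (y, q)) :=
        Finset.sum_congr rfl fun x _ ↦ Finset.sum_comm
    _ = _ := by
      rw [Finset.sum_comm]
      exact Finset.sum_congr rfl fun k _ ↦ Finset.sum_congr rfl fun x _ ↦
        Finset.sum_congr rfl fun y _ ↦ by ring

theorem strongDual_apply_eq_sum [DecidableEq ι] [DecidableEq b] (f : StrongDual ℝ (ι → b → b → ℝ)) :
    ∃ B : ι → Matrix b b ℝ, ∀ y, f y = ∑ i, ∑ p, ∑ q, B i p q * y i p q := by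
  refine ⟨fun i ↦ of fun p q ↦ f (Pi.single i (Pi.single p (Pi.single q 1))), fun y ↦ ?_⟩
  have hy : y = ∑ i, ∑ p, ∑ q,
      y i p q • (Pi.single i (Pi.single p (Pi.single q 1)) : ι → b → b → ℝ) := by
    ext i p q
    simp [Finset.sum_apply, Pi.single_apply, apply_ite, ite_apply]
  conv_lhs => rw [hy]
  simp [mul_comm]

theorem sum_kronecker_apply {ι a b : Type*} [Fintype ι] (B : ι → Matrix b b ℝ)
    (A : ι → Matrix a a ℝ) (z w : b × a) :
    (∑ i, B i ⊗ₖ A i) z w = ∑ i, B i z.1 w.1 * A i z.2 w.2 := by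
  simp [Matrix.sum_apply, kroneckerMap_apply]

theorem exists_eq_sum_of_kronecker_of_eq_one [DecidableEq a] [DecidableEq b]
    {A : ι → Matrix a a ℝ} {Y : ι → Matrix b b ℝ} (hA : ∀ i, (A i).IsSymm) (hY : ∀ i, (Y i).IsSymm)
    {c : ι → ℝ} (hc : ∑ i, c i • A i = 1)
    (hcp : ∀ B : ι → Matrix b b ℝ, (∀ i, (B i).IsSymm) → (∑ i, B i ⊗ₖ A i).PosSemidef →
      (∑ i, B i ⊗ₖ Y i).PosSemidef) :
    ∃ (μ : ℕ) (V : Fin μ → Matrix a b ℝ), ∀ i, Y i = ∑ k, (V k)ᵀ * A i * V k := by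
  classical
  apply exists_eq_sum_of_mem_image_contraction
  by_contra hmem
  set C := {P : a × b → a × b → ℝ | (of P).PosSemidef}
  have hconv : Convex ℝ C := by
    intro P hP Q hQ s t hs ht _
    exact (PosSemidef.smul hP hs).add (PosSemidef.smul hQ ht)
  obtain ⟨f, u, hfu, hf⟩ := geometric_hahn_banach_point_closed
    (hconv.linear_image (contraction A)) (isClosed_image_contraction hc) hmem
  have hu : u < 0 := by
    have h0 : (0 : a × b → a × b → ℝ) ∈ C := PosSemidef.zero
    simpa using hf _ ⟨0, h0, rfl⟩
  have hnn : ∀ P ∈ C, 0 ≤ f (contraction A P) := by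
    intro P hP
    by_contra! hneg
    -- The scaling makes `f` equal to `u` at a point of the cone, where it must exceed `u`.
    have hmem : (u / f (contraction A P)) • P ∈ C :=
      PosSemidef.smul hP (div_nonneg_of_nonpos hu.le hneg.le)
    have := hf _ ⟨_, hmem, rfl⟩
    rw [map_smul, map_smul, smul_eq_mul, div_mul_cancel₀ _ hneg.ne] at this
    exact this.false
  obtain ⟨B, hB⟩ := strongDual_apply_eq_sum f
  -- Symmetrizing `B` only doubles `f` on symmetric tuples, and the hypothesis `hcp` needs symmetric
  -- `B`.
  have hswap : ∀ y : ι → b → b → ℝ, (∀ i p q, y i p q = y i q p) →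
      ∑ i, ∑ p, ∑ q, (B i + (B i)ᵀ) p q * y i p q = 2 * f y := by
    intro y hy
    rw [hB, two_mul]
    simp only [Matrix.add_apply, transpose_apply, add_mul, Finset.sum_add_distrib]
    congr 1
    refine Finset.sum_congr rfl fun i _ ↦ ?_
    rw [Finset.sum_comm]
    exact Finset.sum_congr rfl fun p _ ↦ Finset.sum_congr rfl fun q _ ↦ by rw [hy]
  have hBs : ∀ i, (B i + (B i)ᵀ).IsSymm := fun i ↦ by
    rw [IsSymm, transpose_add, transpose_transpose, add_comm]
  have hpos : (∑ i, (B i + (B i)ᵀ) ⊗ₖ A i).PosSemidef := by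
    rw [posSemidef_real_iff]
    refine ⟨fun z w ↦ ?_, fun v ↦ ?_⟩
    · simp only [sum_kronecker_apply]
      exact Finset.sum_congr rfl fun i _ ↦ by
        rw [(hBs i).apply w.1 z.1, (hA i).apply w.2 z.2]
    · let P : a × b → a × b → ℝ := fun z w ↦ v z.swap * v w.swap
      have hP : P ∈ C := by
        have := posSemidef_vecMulVec_self_star (fun z : a × b ↦ v z.swap)
        exact this
      have h2 : ∑ z, ∑ w, v z * (∑ i, (B i + (B i)ᵀ) ⊗ₖ A i) z w * v w
          = ∑ i, ∑ p, ∑ q, (B i + (B i)ᵀ) p q * contraction A P i p q := by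
        simp only [sum_kronecker_apply, contraction_apply, P, Prod.swap_prod_mk,
          Fintype.sum_prod_type, Finset.mul_sum, Finset.sum_mul]
        calc _ = ∑ p, ∑ x, ∑ q, ∑ i, ∑ y, v (p, x) * ((B i + (B i)ᵀ) p q * A i x y) * v (q, y) :=
              Finset.sum_congr rfl fun p _ ↦ Finset.sum_congr rfl fun x _ ↦
                Finset.sum_congr rfl fun q _ ↦ Finset.sum_comm
          _ = ∑ p, ∑ x, ∑ i, ∑ q, ∑ y, v (p, x) * ((B i + (B i)ᵀ) p q * A i x y) * v (q, y) :=
              Finset.sum_congr rfl fun p _ ↦ Finset.sum_congr rfl fun x _ ↦ Finset.sum_comm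
          _ = ∑ p, ∑ i, ∑ x, ∑ q, ∑ y, v (p, x) * ((B i + (B i)ᵀ) p q * A i x y) * v (q, y) :=
              Finset.sum_congr rfl fun p _ ↦ Finset.sum_comm
          _ = ∑ i, ∑ p, ∑ x, ∑ q, ∑ y, v (p, x) * ((B i + (B i)ᵀ) p q * A i x y) * v (q, y) :=
              Finset.sum_comm
          _ = ∑ i, ∑ p, ∑ q, ∑ x, ∑ y, v (p, x) * ((B i + (B i)ᵀ) p q * A i x y) * v (q, y) :=
              Finset.sum_congr rfl fun i _ ↦ Finset.sum_congr rfl fun p _ ↦ Finset.sum_comm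
          _ = _ := Finset.sum_congr rfl fun i _ ↦ Finset.sum_congr rfl fun p _ ↦
              Finset.sum_congr rfl fun q _ ↦ Finset.sum_congr rfl fun x _ ↦
              Finset.sum_congr rfl fun y _ ↦ by ring
      rw [h2, hswap]
      · exact mul_nonneg zero_le_two (hnn P hP)
      · intro i p q
        simp only [contraction_apply]
        rw [Finset.sum_comm]
        exact Finset.sum_congr rfl fun x _ ↦ Finset.sum_congr rfl fun y _ ↦ by
          rw [(hA i).apply x y]; simp only [P]; ring
  -- Testing on `∑ e_p ⊗ e_p` turns the Kronecker sum into the pairing `2 f(Y)`, which is negative.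
  have hfin := (posSemidef_real_iff.1 (hcp _ hBs hpos)).2 fun z ↦ if z.1 = z.2 then 1 else 0
  have heq : ∑ z : b × b, ∑ w : b × b, (if z.1 = z.2 then (1 : ℝ) else 0) *
      (∑ i, (B i + (B i)ᵀ) ⊗ₖ Y i) z w * (if w.1 = w.2 then 1 else 0)
      = ∑ i, ∑ p, ∑ q, (B i + (B i)ᵀ) p q * Y i p q := by
    simp only [sum_kronecker_apply, Fintype.sum_prod_type, ite_mul, mul_ite, one_mul, zero_mul,
      mul_one, mul_zero, Finset.sum_ite_eq, Finset.mem_univ, if_true]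
    calc _ = ∑ p, ∑ i, ∑ q, (B i + (B i)ᵀ) p q * Y i p q :=
          Finset.sum_congr rfl fun p _ ↦ by simpa using Finset.sum_comm
      _ = _ := Finset.sum_comm
  rw [heq, hswap (fun i p q ↦ Y i p q) fun i p q ↦ (hY i).apply q p] at hfin
  linarith

theorem one_kronecker_congr {d a e : Type*} [Fintype d] [DecidableEq d] [Fintype a] [Fintype e]
    (B : Matrix d d ℝ) (A : Matrix a a ℝ) (S : Matrix a e ℝ) :
    ((1 : Matrix d d ℝ) ⊗ₖ S)ᵀ * (B ⊗ₖ A) * ((1 : Matrix d d ℝ) ⊗ₖ S) = B ⊗ₖ (Sᵀ * A * S) := by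
  rw [← kroneckerMap_transpose, ← mul_kronecker_mul, ← mul_kronecker_mul, transpose_one, one_mul,
    mul_one]

theorem PosSemidef.transpose_mul_mul_same {M : Matrix a a ℝ} (hM : M.PosSemidef)
    (B : Matrix a b ℝ) : (Bᵀ * M * B).PosSemidef := by
  simpa using hM.conjTranspose_mul_mul_same B

/-- Congruence by `S⁻¹`, where the definite combination is `Sᵀ S`, normalizes it to the identity. -/
theorem exists_eq_sum_of_kronecker [DecidableEq a] [DecidableEq b]
    {A : ι → Matrix a a ℝ} {Y : ι → Matrix b b ℝ} (hA : ∀ i, (A i).IsSymm) (hY : ∀ i, (Y i).IsSymm)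
    {c : ι → ℝ} (hc : (∑ i, c i • A i).PosDef)
    (hcp : ∀ B : ι → Matrix b b ℝ, (∀ i, (B i).IsSymm) → (∑ i, B i ⊗ₖ A i).PosSemidef →
      (∑ i, B i ⊗ₖ Y i).PosSemidef) :
    ∃ (μ : ℕ) (V : Fin μ → Matrix a b ℝ), ∀ i, Y i = ∑ k, (V k)ᵀ * A i * V k := by
  obtain ⟨S, hS, hSM⟩ := hc.exists_isUnit_eq_transpose_mul_self
  have hdet := (isUnit_iff_isUnit_det S).1 hS
  have h1 : S⁻¹ * S = 1 := nonsing_inv_mul S hdet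
  have h2 : S * S⁻¹ = 1 := mul_nonsing_inv S hdet
  have h3 : Sᵀ * S⁻¹ᵀ = 1 := by rw [← transpose_mul, h1, transpose_one]
  have h4 : S⁻¹ᵀ * Sᵀ = 1 := by rw [← transpose_mul, h2, transpose_one]
  obtain ⟨μ, V, hV⟩ := exists_eq_sum_of_kronecker_of_eq_one (A := fun i ↦ S⁻¹ᵀ * A i * S⁻¹)
    (Y := Y) (c := c) (fun i ↦ by
      rw [IsSymm, transpose_mul, transpose_mul, transpose_transpose, (hA i).eq, Matrix.mul_assoc])
    hY (by
      calc ∑ i, c i • (S⁻¹ᵀ * A i * S⁻¹) = S⁻¹ᵀ * (∑ i, c i • A i) * S⁻¹ := by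
            simp [Matrix.mul_sum, Matrix.sum_mul]
        _ = 1 := by
            rw [hSM, ← Matrix.mul_assoc, h4, Matrix.one_mul, h2])
    (fun B hB hpos ↦ hcp B hB (by
      have := PosSemidef.transpose_mul_mul_same hpos ((1 : Matrix b b ℝ) ⊗ₖ S)
      rw [Matrix.mul_sum, Matrix.sum_mul] at this
      convert this using 2 with i
      rw [one_kronecker_congr]
      congr 1
      rw [← Matrix.mul_assoc, ← Matrix.mul_assoc, h3, Matrix.one_mul, Matrix.mul_assoc, h1,
        Matrix.mul_one]))
  refine ⟨μ, fun k ↦ S⁻¹ * V k, fun i ↦ (hV i).trans (Finset.sum_congr rfl fun k _ ↦ ?_)⟩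
  simp only [transpose_mul, Matrix.mul_assoc]

end Cone

/-! ### Pencils, their homogenizations and the easy implication. -/

namespace LinearPencil

variable {n m m₁ m₂ : ℕ}

/-- The coefficients of the homogenization of the pencil. -/
def homCoeff (L : LinearPencil n m) (o : Option (Fin n)) : Matrix (Fin m) (Fin m) ℝ :=
  o.elim L.const L.coeff

theorem homCoeff_isSymm (L : LinearPencil n m) (o : Option (Fin n)) : (L.homCoeff o).IsSymm := by
  cases o with
  | none => exact L.const_symm
  | some i => exact L.coeff_symm i

theorem map_eval_toPolyMatrix (L : LinearPencil n m) (x : Fin n → ℝ) :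
    L.toPolyMatrix.map (MvPolynomial.eval x) = L.eval x := by
  ext p q
  simp [toPolyMatrix, eval, Matrix.sum_apply]

theorem transpose_mul_one_kronecker_mul {R : Type*} [CommRing R] {κ a b : Type*} [Fintype κ]
    [DecidableEq κ] [Fintype a] (V : Matrix (κ × a) b R) (A : Matrix a a R) :
    Vᵀ * ((1 : Matrix κ κ R) ⊗ₖ A) * V =
      ∑ k, (of fun x p ↦ V (k, x) p)ᵀ * A * (of fun x p ↦ V (k, x) p) := by
  ext p q
  simp only [Matrix.sum_apply, Matrix.mul_apply, transpose_apply, of_apply, kroneckerMap_apply,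
    Matrix.one_apply, Fintype.sum_prod_type, ite_mul, mul_ite, one_mul, zero_mul, mul_zero]
  refine Finset.sum_congr rfl fun k _ ↦ Finset.sum_congr rfl fun y _ ↦ ?_
  congr 1
  rw [Finset.sum_comm]
  simp

theorem toPolyMatrix_eq_iff (L₁ : LinearPencil n m₁) (L₂ : LinearPencil n m₂) {μ : ℕ}
    (V : Matrix (Fin μ × Fin m₁) (Fin m₂) ℝ) :
    L₂.toPolyMatrix =
      (Vᵀ.map MvPolynomial.C : Matrix (Fin m₂) (Fin μ × Fin m₁) (MvPolynomial (Fin n) ℝ)) *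
        ((1 : Matrix (Fin μ) (Fin μ) (MvPolynomial (Fin n) ℝ)) ⊗ₖ L₁.toPolyMatrix) *
        (V.map MvPolynomial.C : Matrix (Fin μ × Fin m₁) (Fin m₂) (MvPolynomial (Fin n) ℝ)) ↔
    ∀ x, L₂.eval x = ∑ k, (of fun a p ↦ V (k, a) p)ᵀ * L₁.eval x * (of fun a p ↦ V (k, a) p) := by
  have key : ∀ x : Fin n → ℝ,
      ((Vᵀ.map MvPolynomial.C : Matrix (Fin m₂) (Fin μ × Fin m₁) (MvPolynomial (Fin n) ℝ)) *
        ((1 : Matrix (Fin μ) (Fin μ) (MvPolynomial (Fin n) ℝ)) ⊗ₖ L₁.toPolyMatrix) *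
        (V.map MvPolynomial.C :
          Matrix (Fin μ × Fin m₁) (Fin m₂) (MvPolynomial (Fin n) ℝ))).map (MvPolynomial.eval x) =
      ∑ k, (of fun a p ↦ V (k, a) p)ᵀ * L₁.eval x * (of fun a p ↦ V (k, a) p) := by
    intro x
    rw [← transpose_mul_one_kronecker_mul, Matrix.map_mul, Matrix.map_mul,
      ← map_eval_toPolyMatrix]
    congr 1
    · congr 1
      · ext; simp
      · ext z w
        by_cases hzw : z.1 = w.1 <;> simp [kroneckerMap_apply, Matrix.one_apply, hzw]
    · ext; simp
  constructor
  · intro h x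
    rw [← key, ← h, map_eval_toPolyMatrix]
  · intro h
    -- Polynomials over the infinite field `ℝ` are determined by their values.
    refine Matrix.ext fun p q ↦ MvPolynomial.funext fun x ↦ ?_
    have := congrFun (congrFun ((map_eval_toPolyMatrix L₂ x).trans ((h x).trans (key x).symm)) p) q
    simpa only [Matrix.map_apply] using this

theorem eval_eq_sum_iff (L₁ : LinearPencil n m₁) (L₂ : LinearPencil n m₂) {κ : Type*} [Fintype κ]
    (V : κ → Matrix (Fin m₁) (Fin m₂) ℝ) :
    (∀ x, L₂.eval x = ∑ k, (V k)ᵀ * L₁.eval x * V k) ↔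
      ∀ o, L₂.homCoeff o = ∑ k, (V k)ᵀ * L₁.homCoeff o * V k := by
  constructor
  · intro h
    have h0 : L₂.const = ∑ k, (V k)ᵀ * L₁.const * V k := by simpa [eval] using h 0
    rintro (_ | i)
    · exact h0
    · have := h (Pi.single i 1)
      simp only [eval, Pi.single_apply, ite_smul, one_smul, zero_smul, Finset.sum_ite_eq',
        Finset.mem_univ, if_true, Matrix.mul_add, Matrix.add_mul, Finset.sum_add_distrib] at this
      rw [← h0] at this
      exact add_left_cancel this
  · intro h x
    have h0 : L₂.const = ∑ k, (V k)ᵀ * L₁.const * V k := h none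
    have hi : ∀ i, L₂.coeff i = ∑ k, (V k)ᵀ * L₁.coeff i * V k := fun i ↦ h (some i)
    simp only [eval, h0, hi, Matrix.mul_add, Matrix.add_mul, Finset.sum_add_distrib,
      Matrix.mul_sum, Matrix.sum_mul, Finset.smul_sum, Matrix.mul_smul, Matrix.smul_mul]
    rw [Finset.sum_comm]

/-- The homogenized evaluation `∑ Bᵢ ⊗ Aᵢ`, the variable of the constant term included. -/
def homEval (L : LinearPencil n m) {d : ℕ} (B : Option (Fin n) → Matrix (Fin d) (Fin d) ℝ) :
    Matrix (Fin d × Fin m) (Fin d × Fin m) ℝ :=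
  ∑ o, B o ⊗ₖ L.homCoeff o

theorem matEval_eq_homEval (L : LinearPencil n m) {d : ℕ} (Z : Fin n → Matrix (Fin d) (Fin d) ℝ) :
    L.matEval Z = L.homEval fun o ↦ o.elim 1 Z := by
  simp [homEval, matEval, Fintype.sum_option, homCoeff]

theorem matSpectrahedron_subset_of_homCoeff {L₁ : LinearPencil n m₁} {L₂ : LinearPencil n m₂}
    {κ : Type*} [Fintype κ] (V : κ → Matrix (Fin m₁) (Fin m₂) ℝ)
    (h : ∀ o, L₂.homCoeff o = ∑ k, (V k)ᵀ * L₁.homCoeff o * V k) :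
    L₁.matSpectrahedron ⊆ L₂.matSpectrahedron := by
  rintro ⟨d, Z⟩ ⟨hd, hs, hZ⟩
  refine ⟨hd, hs, ?_⟩
  dsimp only at hZ ⊢
  rw [matEval_eq_homEval] at hZ ⊢
  have : L₂.homEval (fun o ↦ o.elim 1 Z) = ∑ k, ((1 : Matrix (Fin d) (Fin d) ℝ) ⊗ₖ V k)ᵀ *
      L₁.homEval (fun o ↦ o.elim 1 Z) * ((1 : Matrix (Fin d) (Fin d) ℝ) ⊗ₖ V k) := by
    simp only [homEval, h, Matrix.mul_sum, Matrix.sum_mul, one_kronecker_congr]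
    rw [Finset.sum_comm]
    refine Finset.sum_congr rfl fun o _ ↦ ?_
    ext z w
    simp [Matrix.sum_apply, kroneckerMap_apply, Finset.mul_sum]
  rw [this]
  exact posSemidef_sum _ fun k _ ↦ PosSemidef.transpose_mul_mul_same hZ _

/-! ### Consequences of boundedness. -/

theorem not_posDef_zero (hm : 1 ≤ m) : ¬ (0 : Matrix (Fin m) (Fin m) ℝ).PosDef := fun h ↦ by
  simpa using h.diag_pos (i := ⟨0, hm⟩)

/-- A nonzero such `y` would span a half-line from `x` inside the spectrahedron. -/
theorem eq_zero_of_posSemidef_recession {L : LinearPencil n m} (hne : L.spectrahedron.Nonempty)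
    (hbdd : Bornology.IsBounded L.spectrahedron) {y : Fin n → ℝ}
    (hy : (∑ i, y i • L.coeff i).PosSemidef) : y = 0 := by
  obtain ⟨x, hx⟩ := hne
  by_contra hy0
  obtain ⟨R, hR⟩ := hbdd.exists_norm_le
  have hmem : ∀ t : ℝ, 0 ≤ t → x + t • y ∈ L.spectrahedron := by
    intro t ht
    have : L.eval (x + t • y) = L.eval x + t • ∑ i, y i • L.coeff i := by
      simp [eval, add_smul, Finset.sum_add_distrib, Finset.smul_sum, smul_smul, add_assoc]
    change (L.eval (x + t • y)).PosSemidef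
    rw [this]
    exact hx.add (hy.smul ht)
  have hypos : 0 < ‖y‖ := norm_pos_iff.2 hy0
  have hR0 : 0 ≤ R := (norm_nonneg x).trans (hR x hx)
  let t := (R + ‖x‖ + 1) / ‖y‖
  have ht : 0 ≤ t := by positivity
  have h1 := hR _ (hmem t ht)
  have h2 : ‖t • y‖ = R + ‖x‖ + 1 := by
    rw [norm_smul, Real.norm_of_nonneg ht, div_mul_cancel₀ _ hypos.ne']
  have h3 : ‖t • y‖ ≤ ‖x + t • y‖ + ‖x‖ := by
    simpa using norm_sub_le (x + t • y) x
  linarith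

theorem exists_eval_posDef (hm : 1 ≤ m) {L : LinearPencil n m} (hne : L.spectrahedron.Nonempty)
    (hbdd : Bornology.IsBounded L.spectrahedron) (hpd : ∃ A ∈ L.operatorSystem, A.PosDef) :
    ∃ x, (L.eval x).PosDef := by
  obtain ⟨A, hA, hApd⟩ := hpd
  rw [operatorSystem, Submodule.mem_span_insert] at hA
  obtain ⟨s, B, hB, rfl⟩ := hA
  obtain ⟨c, rfl⟩ := (Submodule.mem_span_range_iff_exists_fun ℝ).1 hB
  obtain hs | hs := lt_or_ge 0 s
  · refine ⟨fun i ↦ s⁻¹ * c i, ?_⟩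
    have : L.eval (fun i ↦ s⁻¹ * c i) = s⁻¹ • (s • L.const + ∑ i, c i • L.coeff i) := by
      simp [eval, Finset.smul_sum, smul_smul, hs.ne']
    rw [this]
    exact hApd.smul (inv_pos.2 hs)
  -- For `s ≤ 0`, adding `-s` times `L(x)` cancels the constant term and leaves a definite recession
  -- direction. It must vanish, so the zero matrix would be definite.
  · obtain ⟨x, hx⟩ := hne
    have heq : ∑ i, (c i + (-s) * x i) • L.coeff i =
        (s • L.const + ∑ i, c i • L.coeff i) + (-s) • L.eval x := by
      simp only [eval, add_smul, mul_smul, Finset.sum_add_distrib, smul_add, Finset.smul_sum]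
      module
    have hpos : (∑ i, (c i + (-s) * x i) • L.coeff i).PosDef := by
      rw [heq]
      exact hApd.add_posSemidef (PosSemidef.smul hx (neg_nonneg.2 hs))
    have h0 := eq_zero_of_posSemidef_recession ⟨x, hx⟩ hbdd hpos.posSemidef
    have h0' : ∀ i, c i + (-s) * x i = 0 := fun i ↦ congrFun h0 i
    simp only [h0', zero_smul, Finset.sum_const_zero] at hpos
    exact (not_posDef_zero hm hpos).elim

theorem nonneg_of_homogeneous_posSemidef (hm : 1 ≤ m) {L : LinearPencil n m} {x : Fin n → ℝ}
    (hx : (L.eval x).PosDef) (hbdd : Bornology.IsBounded L.spectrahedron)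
    {b : Option (Fin n) → ℝ} (hb : (∑ o, b o • L.homCoeff o).PosSemidef) : 0 ≤ b none := by
  by_contra! hneg
  have heq : ∑ i, (b (some i) + (-b none) * x i) • L.coeff i =
      (-b none) • L.eval x + ∑ o, b o • L.homCoeff o := by
    simp only [eval, add_smul, mul_smul, Finset.sum_add_distrib, smul_add, Finset.smul_sum,
      Fintype.sum_option, homCoeff, Option.elim]
    module
  have hpos : (∑ i, (b (some i) + (-b none) * x i) • L.coeff i).PosDef := by
    rw [heq]
    exact (hx.smul (neg_pos.2 hneg)).add_posSemidef hb
  have h0 := eq_zero_of_posSemidef_recession ⟨x, hx.posSemidef⟩ hbdd hpos.posSemidef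
  have h0' : ∀ i, b (some i) + (-b none) * x i = 0 := fun i ↦ congrFun h0 i
  simp only [h0', zero_smul, Finset.sum_const_zero] at hpos
  exact not_posDef_zero hm hpos

theorem posSemidef_none_of_homEval_posSemidef (hm : 1 ≤ m) {L : LinearPencil n m} {x : Fin n → ℝ}
    (hx : (L.eval x).PosDef) (hbdd : Bornology.IsBounded L.spectrahedron) {d : ℕ}
    {B : Option (Fin n) → Matrix (Fin d) (Fin d) ℝ} (hB : ∀ o, (B o).IsSymm)
    (hpos : (L.homEval B).PosSemidef) : (B none).PosSemidef := by
  rw [posSemidef_real_iff]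
  refine ⟨fun p q ↦ (hB none).apply q p, fun v ↦ ?_⟩
  refine nonneg_of_homogeneous_posSemidef hm hx hbdd
    (b := fun o ↦ ∑ p, ∑ q, v p * B o p q * v q) ?_
  -- Compression by `W = v ⊗ I` reduces the matrix case to scalars `vᵀ B o v`.
  let W : Matrix (Fin d × Fin m) (Fin m) ℝ := of fun z y ↦ if z.2 = y then v z.1 else 0
  convert PosSemidef.transpose_mul_mul_same hpos W using 1
  simp only [homEval, Matrix.mul_sum, Matrix.sum_mul]
  refine Finset.sum_congr rfl fun o _ ↦ ?_
  ext y z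
  simp only [Matrix.smul_apply, smul_eq_mul, Matrix.mul_apply, transpose_apply, W, of_apply,
    kroneckerMap_apply, Fintype.sum_prod_type, ite_mul, mul_ite, zero_mul, mul_zero,
    Finset.sum_ite_eq', Finset.mem_univ, if_true, Finset.sum_mul]
  rw [Finset.sum_comm]
  exact Finset.sum_congr rfl fun p _ ↦ Finset.sum_congr rfl fun q _ ↦ by ring

/-! ### From inclusion to homogeneous positivity. -/

theorem kronecker_one_congr {d a : Type*} [Fintype d] [Fintype a] [DecidableEq a]
    (B S : Matrix d d ℝ) (A : Matrix a a ℝ) :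
    (S ⊗ₖ (1 : Matrix a a ℝ))ᵀ * (B ⊗ₖ A) * (S ⊗ₖ (1 : Matrix a a ℝ)) = (Sᵀ * B * S) ⊗ₖ A := by
  rw [← kroneckerMap_transpose, ← mul_kronecker_mul, ← mul_kronecker_mul, transpose_one, one_mul,
    mul_one]

theorem homEval_congr (L : LinearPencil n m) {d : ℕ} (S : Matrix (Fin d) (Fin d) ℝ)
    (B : Option (Fin n) → Matrix (Fin d) (Fin d) ℝ) :
    L.homEval (fun o ↦ Sᵀ * B o * S) =
      (S ⊗ₖ (1 : Matrix (Fin m) (Fin m) ℝ))ᵀ * L.homEval B *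
        (S ⊗ₖ (1 : Matrix (Fin m) (Fin m) ℝ)) := by
  simp only [homEval, Matrix.mul_sum, Matrix.sum_mul, kronecker_one_congr]

theorem homEval_posSemidef_of_posDef_none {L₁ : LinearPencil n m₁} {L₂ : LinearPencil n m₂}
    (h : L₁.matSpectrahedron ⊆ L₂.matSpectrahedron) {d : ℕ} (hd : 1 ≤ d)
    {B : Option (Fin n) → Matrix (Fin d) (Fin d) ℝ} (hB : ∀ o, (B o).IsSymm)
    (hB0 : (B none).PosDef) (hpos : (L₁.homEval B).PosSemidef) : (L₂.homEval B).PosSemidef := by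
  obtain ⟨S, hS, hSB⟩ := hB0.exists_isUnit_eq_transpose_mul_self
  have hdet := (isUnit_iff_isUnit_det S).1 hS
  have h1 : S⁻¹ * S = 1 := nonsing_inv_mul S hdet
  have h2 : S * S⁻¹ = 1 := mul_nonsing_inv S hdet
  have h3 : Sᵀ * S⁻¹ᵀ = 1 := by rw [← transpose_mul, h1, transpose_one]
  have h4 : S⁻¹ᵀ * Sᵀ = 1 := by rw [← transpose_mul, h2, transpose_one]
  let Z : Fin n → Matrix (Fin d) (Fin d) ℝ := fun i ↦ S⁻¹ᵀ * B (some i) * S⁻¹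
  have hZ : (fun o : Option (Fin n) ↦ o.elim 1 Z) = fun o ↦ S⁻¹ᵀ * B o * S⁻¹ := by
    ext1 o
    cases o with
    | none => rw [hSB, ← Matrix.mul_assoc, h4, Matrix.one_mul, h2]; rfl
    | some i => rfl
  have hmem : (⟨d, Z⟩ : Σ d : ℕ, (Fin n → Matrix (Fin d) (Fin d) ℝ)) ∈ L₁.matSpectrahedron := by
    refine ⟨hd, fun i ↦ ?_, ?_⟩
    · simp only [Z]
      rw [IsSymm, transpose_mul, transpose_mul, transpose_transpose, (hB _).eq, Matrix.mul_assoc]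
    · dsimp only
      rw [matEval_eq_homEval, hZ, homEval_congr]
      exact PosSemidef.transpose_mul_mul_same hpos _
  have h5 := (h hmem).2.2
  dsimp only at h5
  rw [matEval_eq_homEval, hZ] at h5
  have h6 := PosSemidef.transpose_mul_mul_same h5 (S ⊗ₖ (1 : Matrix (Fin m₂) (Fin m₂) ℝ))
  rw [← homEval_congr] at h6
  convert h6 using 3 with o
  rw [← Matrix.mul_assoc, ← Matrix.mul_assoc, h3, Matrix.one_mul, Matrix.mul_assoc, h1,
    Matrix.mul_one]

theorem homEval_posSemidef_of_matSpectrahedron_subset (hm : 1 ≤ m₁) {L₁ : LinearPencil n m₁}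
    {L₂ : LinearPencil n m₂} {x : Fin n → ℝ} (hx : (L₁.eval x).PosDef)
    (hbdd : Bornology.IsBounded L₁.spectrahedron)
    (h : L₁.matSpectrahedron ⊆ L₂.matSpectrahedron) {d : ℕ} (hd : 1 ≤ d)
    {B : Option (Fin n) → Matrix (Fin d) (Fin d) ℝ} (hB : ∀ o, (B o).IsSymm)
    (hpos : (L₁.homEval B).PosSemidef) : (L₂.homEval B).PosSemidef := by
  have hB0 := posSemidef_none_of_homEval_posSemidef hm hx hbdd hB hpos
  -- `E` is the interior point `(1, x)` times the identity; adding `ε E` makes `B none` definite and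
  -- keeps `L₁` positive.
  let E : Option (Fin n) → Matrix (Fin d) (Fin d) ℝ := fun o ↦ o.elim (1 : ℝ) x • 1
  have hE : ∀ {k : ℕ} (L : LinearPencil n k),
      L.homEval E = (1 : Matrix (Fin d) (Fin d) ℝ) ⊗ₖ L.eval x := by
    intro k L
    simp only [homEval, E, Fintype.sum_option, homCoeff, Option.elim, eval, one_smul,
      kronecker_add, smul_kronecker]
    congr 1
    ext z w
    simp [Matrix.sum_apply, kroneckerMap_apply, Finset.mul_sum, mul_left_comm]
  have hadd : ∀ {k : ℕ} (L : LinearPencil n k) (ε : ℝ),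
      L.homEval (fun o ↦ B o + ε • E o) = L.homEval B + ε • L.homEval E := by
    intro k L ε
    simp only [homEval, add_kronecker, smul_kronecker, Finset.sum_add_distrib, Finset.smul_sum]
  have hsymm : ∀ ε : ℝ, ∀ o, (B o + ε • E o).IsSymm := fun ε o ↦ by
    simp only [IsSymm, E, transpose_add, transpose_smul, transpose_one, (hB o).eq]
  have hε : ∀ ε : ℝ, 0 < ε → (L₂.homEval B + ε • L₂.homEval E).PosSemidef := by
    intro ε hε
    rw [← hadd]
    refine homEval_posSemidef_of_posDef_none h hd (hsymm ε) ?_ ?_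
    · have : E none = 1 := one_smul ℝ _
      rw [this]
      exact PosDef.posSemidef_add hB0 (PosDef.one.smul hε)
    · rw [hadd, hE]
      exact hpos.add ((PosSemidef.one.kronecker hx.posSemidef).smul hε.le)
  rw [posSemidef_real_iff]
  refine ⟨fun z w ↦ ?_, fun v ↦ ?_⟩
  · simp only [homEval, sum_kronecker_apply]
    exact Finset.sum_congr rfl fun o _ ↦ by
      rw [(hB o).apply w.1 z.1, (L₂.homCoeff_isSymm o).apply w.2 z.2]
  · let r := ∑ z, ∑ w, v z * (L₂.homEval E) z w * v w
    have hq : ∀ ε : ℝ, 0 < ε → 0 ≤ (∑ z, ∑ w, v z * (L₂.homEval B) z w * v w) + ε * r := by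
      intro ε hε0
      have := (posSemidef_real_iff.1 (hε ε hε0)).2 v
      convert this using 1
      simp only [r, Finset.mul_sum, ← Finset.sum_add_distrib, Matrix.add_apply, Matrix.smul_apply,
        smul_eq_mul]
      exact Finset.sum_congr rfl fun z _ ↦ Finset.sum_congr rfl fun w _ ↦ by ring
    have hlim : Filter.Tendsto
        (fun ε : ℝ ↦ (∑ z, ∑ w, v z * (L₂.homEval B) z w * v w) + ε * r)
        (nhdsWithin 0 (Set.Ioi 0)) (nhds (∑ z, ∑ w, v z * (L₂.homEval B) z w * v w)) := by
      refine Filter.Tendsto.mono_left ?_ nhdsWithin_le_nhds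
      have : Continuous fun ε : ℝ ↦ (∑ z, ∑ w, v z * (L₂.homEval B) z w * v w) + ε * r := by
        fun_prop
      simpa using this.tendsto 0
    exact ge_of_tendsto hlim (eventually_nhdsWithin_of_forall fun ε hε0 ↦ hq ε hε0)

theorem exists_homCoeff_eq_sum (hm : 1 ≤ m₁) {L₁ : LinearPencil n m₁}
    {L₂ : LinearPencil n m₂} {x : Fin n → ℝ} (hx : (L₁.eval x).PosDef)
    (hbdd : Bornology.IsBounded L₁.spectrahedron)
    (h : L₁.matSpectrahedron ⊆ L₂.matSpectrahedron) :
    ∃ (μ : ℕ) (V : Fin μ → Matrix (Fin m₁) (Fin m₂) ℝ),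
      ∀ o, L₂.homCoeff o = ∑ k, (V k)ᵀ * L₁.homCoeff o * V k := by
  refine exists_eq_sum_of_kronecker L₁.homCoeff_isSymm L₂.homCoeff_isSymm
    (c := fun o ↦ o.elim 1 x) ?_ fun B hB hpos ↦ ?_
  · simpa [Fintype.sum_option, homCoeff, eval] using hx
  -- Size `0` is separate because matricial spectrahedra require `d ≥ 1`.
  · obtain rfl | hm₂ := Nat.eq_zero_or_pos m₂
    · rw [posSemidef_real_iff]
      exact ⟨fun z ↦ z.1.elim0, fun v ↦ by simp⟩
    · exact homEval_posSemidef_of_matSpectrahedron_subset hm hx hbdd h hm₂ hB hpos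

end LinearPencil

end

theorem mainTheorem12 {n m₁ m₂ : ℕ} (hm₁ : 1 ≤ m₁)
    (L₁ : LinearPencil n m₁) (L₂ : LinearPencil n m₂)
    (hne : L₁.spectrahedron.Nonempty)
    (hbdd : Bornology.IsBounded L₁.spectrahedron)
    (hpd : ∃ A ∈ L₁.operatorSystem, A.PosDef) :
    L₁.matSpectrahedron ⊆ L₂.matSpectrahedron ↔
      ∃ μ : ℕ, 1 ≤ μ ∧ ∃ V : Matrix (Fin μ × Fin m₁) (Fin m₂) ℝ,
        L₂.toPolyMatrix =
          (V.transpose.map MvPolynomial.C :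
              Matrix (Fin m₂) (Fin μ × Fin m₁) (MvPolynomial (Fin n) ℝ)) *
            ((1 : Matrix (Fin μ) (Fin μ) (MvPolynomial (Fin n) ℝ)) ⊗ₖ L₁.toPolyMatrix) *
            (V.map MvPolynomial.C :
              Matrix (Fin μ × Fin m₁) (Fin m₂) (MvPolynomial (Fin n) ℝ)) := by
  simp only [LinearPencil.toPolyMatrix_eq_iff, LinearPencil.eval_eq_sum_iff]
  constructor
  · intro h
    obtain ⟨x, hx⟩ := LinearPencil.exists_eval_posDef hm₁ hne hbdd hpd
    obtain ⟨μ, V, hV⟩ := LinearPencil.exists_homCoeff_eq_sum hm₁ hx hbdd h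
    -- A zero block is prepended since `μ` may be `0`.
    let V' : Fin (μ + 1) → Matrix (Fin m₁) (Fin m₂) ℝ := Fin.cons 0 V
    refine ⟨μ + 1, Nat.succ_pos μ, Matrix.of fun z p ↦ V' z.1 z.2 p, fun o ↦ ?_⟩
    change _ = ∑ k, (V' k).transpose * L₁.homCoeff o * V' k
    rw [Fin.sum_univ_succ, hV]
    simp [V']
  · rintro ⟨μ, -, V, hV⟩
    exact LinearPencil.matSpectrahedron_subset_of_homCoeff _ hV
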